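/- Let $\mathbf{C}$ be an essentially small (locally small) category with pushouts. **Conventions.** A square of ordered sets $g\colon A\to C$, $f\colon A\to B$, $u\colon B\to D$, $v\colon C\to D$ with $u f\le v g$ (composition of functions) has the *interpolation property* if whenever $u(b)\le v(c)$ with $b\in B$, $c\in C$, there is $a\in A$ with $b\le f(a)$ and $g(a)\le c$. A commutative square can be regarded as such a lax square in two directions, "$\le$" and (exchanging the roles of $B$ and $C$) "$\ge$". A map of ordered sets is *bounded* if it sends up-sets to up-sets. A *compact ordered space* is a compact space with a partial order that is closed in the square of the space; morphisms are the continuous order-preserving maps, and the category is denoted $\mathbf{KOrd}$. A *polyadic compact ordered space* over $\mathbf{C}$ is a functor $S\colon \mathbf{C}^{op}\to\mathbf{KOrd}$ that sends every pushout square of $\mathbf{C}$ to a square with the interpolation property and every morphism to a bounded map. It is *open* if every $S(\sigma)$ sends open up-sets to open up-sets. A *morphism* $\tau\colon S_1\to S_2$ of polyadic compact ordered spaces is a natural transformation such that for every $\sigma\colon n\to m$ in $\mathbf{C}$ the naturality square has the interpolation property in the direction: if $S_2(\sigma)(b)\le\tau_n(c)$, with $b\in S_2(m)$ and $c\in S_1(n)$,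 there is $a\in S_1(m)$ with $b\le\tau_m(a)$ and $S_1(\sigma)(a)\le c$. It is *intuitionistic* if moreover every $\tau_n$ is bounded and the opposite interpolation property holds: if $\tau_n(c)\le S_2(\sigma)(b)$, there is $a\in S_1(m)$ with $c\le S_1(\sigma)(a)$ and $\tau_m(a)\le b$. An *ind-object* of $\mathbf{C}$ is a presheaf $X\colon\mathbf{C}^{op}\to\mathbf{Set}$ that is a small filtered colimit of representables. For a set $Y$, $\beta Y$ is its Stone–Čech compactification (the space of ultrafilters on $Y$) with the discrete order. A *model* of an open polyadic compact ordered space $S$ is an ind-object $X$ with a morphism $\beta\circ X\to S$ of polyadic compact ordered spaces. A morphism $f\colon S\to P$ is *injective on models* if for every ind-object $X$ and all models $x,y\colon\beta\circ X\to S$, $f\circ x=f\circ y$ implies $x=y$. **Statement (polyadic spaces).** Let $S,P$ be polyadic compact ordered spaces over $\mathbf{C}$ with $S$ open, and let $f\colon S\to P$ be an intuitionistic morphism. If $f$ is injective on models, then $f$ is a pointwise embedding: for every object $n$ of $\mathbf{C}$, the map $f_n\colon S(n)\to P(n)$ is a topological embedding and satisfies $f_n(x)\le f_n(y)\iff x\le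 y$. **Statement (dual form: Beth definability).** An *intuitionistic hyperdoctrine* over $\mathbf{C}$ is a functor $D$ from $\mathbf{C}$ to Heyting algebras that sends pushout squares to squares with the interpolation property and such that every $D(\sigma)$ has a left and a right adjoint (as a monotone map). A *morphism* $\tau\colon D_1\to D_2$ is a natural transformation (by Heyting homomorphisms) whose naturality squares have, for every $\sigma\colon n\to m$, the interpolation property in both directions: if $\tau_m(b)\le D_2(\sigma)(c)$ with $b\in D_1(m)$, $c\in D_2(n)$, there is $a\in D_1(n)$ with $b\le D_1(\sigma)(a)$ and $\tau_n(a)\le c$; and if $D_2(\sigma)(c)\le\tau_m(b)$, there is $a\in D_1(n)$ with $c\le\tau_n(a)$ and $D_1(\sigma)(a)\le b$. A *model* of $D$ is an ind-object $X$ with a natural transformation by bounded lattice homomorphisms $D(n)\to\mathcal{P}(X(n))$ whose naturality squares have the first of these two interpolation properties (that is, a morphism of coherent hyperdoctrines from $D$ to the hyperdoctrine of predicates on $X$). Let $\tau\colon D_1\to D_2$ be a morphism of intuitionistic hyperdoctrines over $\mathbf{C}$ such that each model of $D_1$ extends along $\tau$ to a model of $D_2$ (on the same ind-object) in at most one way.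 Then $\tau_n\colon D_1(n)\to D_2(n)$ is surjective for every object $n$ of $\mathbf{C}$. -/

import Mathlib

open CategoryTheory CategoryTheory.Limits Opposite

universe w v u

/-! ### Interpolation and bounded maps -/

section Order

/-- The interpolation property of a square
`g : A → C`, `f : A → B`, `u : B → D`, `v : C → D`, regarded as a lax square `u ∘ f ≤ v ∘ g`.
The interpolation property of a commutative square regarded as a lax square in the
opposite direction (`u ∘ f ≥ v ∘ g`) is `Interpolation g f v u`. -/
def Interpolation {A B C D : Type*} [Preorder B] [Preorder C] [Preorder D]
    (f : A → B) (g : A → C) (u : B → D) (v : C → D) : Prop :=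
  ∀ (b : B) (c : C), u b ≤ v c → ∃ a : A, b ≤ f a ∧ g a ≤ c

/-- A map of ordered sets is bounded if it sends up-sets to up-sets. -/
def IsBoundedOrderMap {X Y : Type*} [Preorder X] [Preorder Y] (f : X → Y) : Prop :=
  ∀ U : Set X, IsUpperSet U → IsUpperSet (f '' U)

/-- A map is lower semi-open if it sends open up-sets to open up-sets. -/
def IsLowerSemiOpen {X Y : Type*} [Preorder X] [Preorder Y] [TopologicalSpace X]
    [TopologicalSpace Y] (f : X → Y) : Prop :=
  ∀ U : Set X, IsOpen U → IsUpperSet U → IsOpen (f '' U) ∧ IsUpperSet (f '' U)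

end Order

/-! ### Compact ordered spaces -/

/-- Compact spaces with a partial order that is closed in the square of the space. -/
structure KOrd where
  carrier : Type w
  [topology : TopologicalSpace carrier]
  [order : PartialOrder carrier]
  [compact : CompactSpace carrier]
  [closed : OrderClosedTopology carrier]

namespace KOrd

instance : CoeSort KOrd.{w} (Type w) := ⟨KOrd.carrier⟩

attribute [instance] KOrd.topology KOrd.order KOrd.compact KOrd.closed

/-- Morphisms of compact ordered spaces: continuous order-preserving maps. -/
@[ext]
structure Hom (X Y : KOrd.{w}) where
  hom : X →Co Y

instance : Category KOrd.{w} where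
  Hom X Y := Hom X Y
  id X := ⟨ContinuousOrderHom.id X⟩
  comp f g := ⟨g.hom.comp f.hom⟩

instance : ConcreteCategory KOrd.{w} (fun X Y => X →Co Y) where
  hom f := f.hom
  ofHom f := ⟨f⟩

end KOrd

/-- The Stone–Čech compactification of a discrete set: the Stone space of its power set, realised
as the space of ultrafilters on the set. -/
def BetaSet (X : Type w) : Type w := Ultrafilter X

namespace BetaSet

instance (X : Type w) : TopologicalSpace (BetaSet X) :=
  inferInstanceAs (TopologicalSpace (Ultrafilter X))

instance (X : Type w) : CompactSpace (BetaSet X) :=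
  inferInstanceAs (CompactSpace (Ultrafilter X))

instance (X : Type w) : T2Space (BetaSet X) :=
  inferInstanceAs (T2Space (Ultrafilter X))

/-- The discrete order. -/
instance (X : Type w) : PartialOrder (BetaSet X) where
  le a b := a = b
  le_refl _ := rfl
  le_trans _ _ _ h k := h.trans k
  le_antisymm _ _ h _ := h

instance (X : Type w) : OrderClosedTopology (BetaSet X) where
  isClosed_le' := isClosed_diagonal

theorem continuous_ultrafilter_map {X Y : Type w} (f : X → Y) :
    Continuous (fun p : Ultrafilter X => p.map f) := by
  refine ultrafilterBasis_is_basis.continuous_iff.2 ?_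
  rintro _ ⟨s, rfl⟩
  exact ultrafilter_isOpen_basic (f ⁻¹' s)

/-- The continuous map between Stone–Čech compactifications induced by a map of sets. -/
def map {X Y : Type w} (f : X → Y) : BetaSet X →Co BetaSet Y where
  toFun := Ultrafilter.map f
  monotone' _ _ h := congrArg (Ultrafilter.map f) h
  continuous_toFun := continuous_ultrafilter_map f

end BetaSet

/-- The functor sending a set to its Stone–Čech compactification, with the discrete order. -/
def betaFunctor : Type w ⥤ KOrd.{w} where
  obj X := { carrier := BetaSet X }
  map f := ⟨BetaSet.map (fun x => f x)⟩
  map_id _ := KOrd.Hom.ext (ContinuousOrderHom.ext fun p => Ultrafilter.map_id p)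
  map_comp f g := KOrd.Hom.ext (ContinuousOrderHom.ext fun p =>
    (Ultrafilter.map_map p (fun x => f x) (fun y => g y)).symm)

/-! ### Polyadic compact ordered spaces -/

section Polyadic

variable {C : Type u} [Category.{v} C]

/-- Polyadic compact ordered spaces: functors to compact ordered spaces that send pushout squares
to squares with interpolation, and all maps to bounded maps. -/
structure IsPolyadic (S : Cᵒᵖ ⥤ KOrd.{w}) : Prop where
  interpolation : ∀ {k n m p : C} {f : k ⟶ n} {g : k ⟶ m} {i : n ⟶ p} {j : m ⟶ p},
    IsPushout f g i j →
      Interpolation (S.map i.op) (S.map j.op) (S.map f.op) (S.map g.op)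
  bounded : ∀ {n m : C} (σ : n ⟶ m), IsBoundedOrderMap (S.map σ.op)

/-- Openness of a polyadic compact ordered space. -/
def IsOpenPolyadic (S : Cᵒᵖ ⥤ KOrd.{w}) : Prop :=
  ∀ {n m : C} (σ : n ⟶ m), IsLowerSemiOpen (S.map σ.op)

/-- Morphisms of polyadic compact ordered spaces: natural transformations whose naturality
squares `S m → S n`, `T m → T n` have the interpolation property in the direction `≤`. -/
def IsPolyadicMorphism {S T : Cᵒᵖ ⥤ KOrd.{w}} (τ : S ⟶ T) : Prop :=
  ∀ {n m : C} (σ : n ⟶ m),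
    Interpolation (τ.app (op m)) (S.map σ.op) (T.map σ.op) (τ.app (op n))

/-- Intuitionistic morphisms: morphisms that are pointwise bounded and whose naturality squares
also have the interpolation property in the direction `≥`. -/
structure IsIntuitionisticMorphism {S T : Cᵒᵖ ⥤ KOrd.{w}} (τ : S ⟶ T) : Prop where
  isPolyadicMorphism : IsPolyadicMorphism τ
  bounded : ∀ n : C, IsBoundedOrderMap (τ.app (op n))
  interpolation_ge : ∀ {n m : C} (σ : n ⟶ m),
    Interpolation (S.map σ.op) (τ.app (op m)) (τ.app (op n)) (T.map σ.op)

/-- An `S`-structure on an ind-object `X` (a presheaf of sets on `C`) is a morphism of polyadic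
compact ordered spaces `β ∘ X ⟶ S`. A model of `S` is an ind-object with an `S`-structure. -/
def IsModelOfSpace {S : Cᵒᵖ ⥤ KOrd.{v}} {X : Cᵒᵖ ⥤ Type v} (x : X ⋙ betaFunctor ⟶ S) : Prop :=
  IsIndObject X ∧ IsPolyadicMorphism x

/-- `f : S ⟶ P` is injective on models if two models of `S` on the same ind-object with the
same composite with `f` are equal. -/
def InjectiveOnModels {S P : Cᵒᵖ ⥤ KOrd.{v}} (f : S ⟶ P) : Prop :=
  ∀ (X : Cᵒᵖ ⥤ Type v) (x y : X ⋙ betaFunctor ⟶ S),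
    IsModelOfSpace x → IsModelOfSpace y → x ≫ f = y ≫ f → x = y

/-- Pointwise embeddings of compact ordered spaces: each component is an order embedding and a
topological embedding. -/
def IsPointwiseEmbedding {S P : Cᵒᵖ ⥤ KOrd.{w}} (f : S ⟶ P) : Prop :=
  ∀ n : C, (∀ x y : S.obj (op n), f.app (op n) x ≤ f.app (op n) y ↔ x ≤ y) ∧
    Topology.IsEmbedding (f.app (op n))

end Polyadic

/-! ### Hyperdoctrines -/

section Hyperdoctrines

variable {C : Type u} [Category.{v} C]

/-- Intuitionistic hyperdoctrines: functors to Heyting algebras that send pushout squares to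
squares with interpolation and every map to a map with a left and a right adjoint. -/
structure IsIntuitionisticHyperdoctrine (D : C ⥤ HeytAlg.{w}) : Prop where
  interpolation : ∀ {k n m p : C} {f : k ⟶ n} {g : k ⟶ m} {i : n ⟶ p} {j : m ⟶ p},
    IsPushout f g i j → Interpolation (D.map f) (D.map g) (D.map i) (D.map j)
  leftAdjoint : ∀ {n m : C} (σ : n ⟶ m),
    ∃ l : D.obj m → D.obj n, GaloisConnection l (D.map σ)
  rightAdjoint : ∀ {n m : C} (σ : n ⟶ m),
    ∃ r : D.obj m → D.obj n, GaloisConnection (D.map σ) r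

/-- Morphisms of intuitionistic hyperdoctrines: natural transformations (by Heyting homomorphisms)
whose naturality squares have the interpolation property in both directions. -/
structure IsIntuitionisticHyperdoctrineMorphism {D₁ D₂ : C ⥤ HeytAlg.{w}} (τ : D₁ ⟶ D₂) :
    Prop where
  interpolation_le : ∀ {n m : C} (σ : n ⟶ m),
    Interpolation (D₁.map σ) (τ.app n) (τ.app m) (D₂.map σ)
  interpolation_ge : ∀ {n m : C} (σ : n ⟶ m),
    Interpolation (τ.app n) (D₁.map σ) (D₂.map σ) (τ.app m)

/-- Morphisms of coherent hyperdoctrines: natural transformations whose naturality squares have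
the interpolation property in the direction `≤`. -/
def IsCoherentMorphism {D₁ D₂ : C ⥤ BddDistLat.{w}} (τ : D₁ ⟶ D₂) : Prop :=
  ∀ {n m : C} (σ : n ⟶ m), Interpolation (D₁.map σ) (τ.app n) (τ.app m) (D₂.map σ)

/-- Inverse image along a map, as a homomorphism of bounded lattices. -/
def preimageHom {X Y : Type w} (f : X → Y) : BoundedLatticeHom (Set Y) (Set X) where
  toFun s := f ⁻¹' s
  map_sup' _ _ := rfl
  map_inf' _ _ := rfl
  map_top' := rfl
  map_bot' := rfl

/-- The hyperdoctrine of predicates on `X`: it sends `n` to the power set of `X n`. -/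
def predicateHyperdoctrine (X : Cᵒᵖ ⥤ Type w) : C ⥤ BddDistLat.{w} where
  obj n := BddDistLat.of (Set (X.obj (op n)))
  map σ := BddDistLat.ofHom (preimageHom fun x => X.map σ.op x)
  map_id n := by
    ext s
    simp [preimageHom]
  map_comp σ ρ := by
    ext s x
    simp [preimageHom]
    rfl

/-- The underlying functor to bounded distributive lattices of a functor to Heyting algebras. -/
abbrev underlyingLattices (D : C ⥤ HeytAlg.{w}) : C ⥤ BddDistLat.{w} :=
  D ⋙ forget₂ HeytAlg BddDistLat

/-- A model of `D` is an ind-object `X` with a morphism of coherent hyperdoctrines from `D` to the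
hyperdoctrine of predicates on `X`. -/
def IsModelOfHyperdoctrine {D : C ⥤ HeytAlg.{v}} {X : Cᵒᵖ ⥤ Type v}
    (a : underlyingLattices D ⟶ predicateHyperdoctrine X) : Prop :=
  IsIndObject X ∧ IsCoherentMorphism a

/-- Each model of `D₁` extends along `τ : D₁ ⟶ D₂` to a model of `D₂` in at most one way. -/
def ModelsExtendAtMostOnce {D₁ D₂ : C ⥤ HeytAlg.{v}} (τ : D₁ ⟶ D₂) : Prop :=
  ∀ (X : Cᵒᵖ ⥤ Type v) (c : underlyingLattices D₁ ⟶ predicateHyperdoctrine X)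
    (a b : underlyingLattices D₂ ⟶ predicateHyperdoctrine X),
    IsModelOfHyperdoctrine c → IsModelOfHyperdoctrine a → IsModelOfHyperdoctrine b →
    Functor.whiskerRight τ (forget₂ HeytAlg BddDistLat) ≫ a = c →
    Functor.whiskerRight τ (forget₂ HeytAlg BddDistLat) ≫ b = c → a = b

end Hyperdoctrines

section Iteration

instance preservesColimitsOfShape_fromPUnit {J : Type*} [Category* J] [IsConnected J]
    {K : Type*} [Category* K] (X : K) :
    PreservesColimitsOfShape J (Functor.fromPUnit.{0} X) where
  preservesColimit {F} :=
    { preserves := fun {c} _ => ⟨by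
        let φ (s : Cocone (F ⋙ Functor.fromPUnit.{0} X)) (j : J) : X ⟶ s.pt := s.ι.app j
        have h (s) (i j : J) : φ s i = φ s j :=
          constant_of_preserves_morphisms (φ s)
            (fun i j g => ((Category.id_comp _).symm.trans (s.w g)).symm) i j
        exact
          { desc := fun s => φ s (Classical.arbitrary J)
            fac := fun s j => (Category.id_comp _).trans (h s _ _)
            uniq := fun s m hm =>
              (Category.id_comp (X := X) m).symm.trans (hm (Classical.arbitrary J)) }⟩ }

theorem hasColimitsOfShape_under {J : Type*} [Category* J] [IsConnected J]
    {K : Type*} [Category* K] [HasColimitsOfShape J K] (X : K) :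
    HasColimitsOfShape J (Under X) :=
  Comma.hasColimitsOfShape

open SmallObject in
/-- If every condition from a small family can be forced at every object, conditions persist along
morphisms, and colimits of well-ordered chains exist, then all conditions can be forced at once. -/
theorem exists_hom_forcing_all {K : Type*} [Category* K] {T : Type v} (forces : K → T → Prop)
    (mono : ∀ {X Y : K}, (X ⟶ Y) → ∀ t, forces X t → forces Y t)
    (step : ∀ X t, ∃ Y : K, Nonempty (X ⟶ Y) ∧ forces Y t)
    (hK : ∀ (J : Type v) [LinearOrder J] [Nonempty J], HasColimitsOfShape J K) (X : K) :
    ∃ Y : K, Nonempty (X ⟶ Y) ∧ ∀ t, forces Y t := by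
  classical
  let κ := Order.succ (max (Cardinal.mk T) Cardinal.aleph0)
  have hκ : Cardinal.aleph0 ≤ κ := (le_max_right _ _).trans (Order.le_succ _)
  let J := κ.ord.ToType
  have : NoMaxOrder J := Cardinal.noMaxOrder hκ
  have hJ : Cardinal.mk J = κ := by simp [J]
  have : Nonempty J := by
    rw [← Cardinal.mk_ne_zero_iff, hJ]
    exact (Cardinal.aleph0_pos.trans_le hκ).ne'
  let : OrderBot J := WellFoundedLT.toOrderBot J
  have : HasIterationOfShape J K :=
    { hasColimitsOfShape_of_isSuccLimit := fun j hj =>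
        have : Nonempty (Set.Iio j) := ⟨⟨⊥, hj.bot_lt⟩⟩
        hK _
      hasColimitsOfShape := hK _ }
  have h : ∀ Y : K, ∃ Z : K, ∃ _ : Y ⟶ Z, (∃ t, ¬ forces Y t) → ∃ t, ¬ forces Y t ∧ forces Z t := by
    intro Y
    by_cases hY : ∃ t, ¬ forces Y t
    · obtain ⟨t, ht⟩ := hY
      obtain ⟨Z, ⟨g⟩, hZ⟩ := step Y t
      exact ⟨Z, g, fun _ => ⟨t, ht, hZ⟩⟩
    · exact ⟨Y, 𝟙 Y, fun h => (hY h).elim⟩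
  choose succ toSucc hsucc using h
  let Φ : SuccStruct K := ⟨X, succ, toSucc⟩
  refine ⟨Φ.iteration J, ⟨Φ.ιIteration J⟩, ?_⟩
  by_contra! hn
  obtain ⟨t₀, ht₀⟩ := hn
  let F := Φ.iterationFunctor J
  have key : ∀ j : J, ∃ t, ¬ forces (F.obj j) t ∧ forces (F.obj (Order.succ j)) t := by
    intro j
    obtain ⟨t, h₁, h₂⟩ := hsucc (F.obj j)
      ⟨t₀, fun h => ht₀ (mono (colimit.ι (Φ.iterationFunctor J) j) _ h)⟩
    exact ⟨t, h₁, mono (Φ.iterationFunctorObjSuccIso j (not_isMax j)).inv _ h₂⟩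
  choose t ht₁ ht₂ using key
  have hlt : ∀ i j : J, i < j → t i ≠ t j := by
    intro i j hij he
    exact ht₁ j (he ▸ mono (F.map (homOfLE (Order.succ_le_of_lt hij))) _ (ht₂ i))
  have hinj : Function.Injective t := by
    intro i j he
    rcases lt_trichotomy i j with h | h | h
    · exact (hlt _ _ h he).elim
    · exact h
    · exact (hlt _ _ h he.symm).elim
  have h₁ := Cardinal.mk_le_of_injective hinj
  rw [hJ] at h₁
  exact (Order.lt_succ_of_not_isMax (not_isMax _)).not_ge (h₁.trans (le_max_left _ _))

end Iteration

section OrderTopology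

theorem IsBoundedOrderMap.exists_le_map_eq {X Y : Type*} [Preorder X] [Preorder Y] {f : X → Y}
    (hf : IsBoundedOrderMap f) {x : X} {y : Y} (h : f x ≤ y) : ∃ x', x ≤ x' ∧ f x' = y :=
  hf (Set.Ici x) (isUpperSet_Ici x) h ⟨x, le_rfl, rfl⟩

theorem IsBoundedOrderMap.of_exists {X Y : Type*} [Preorder X] [Preorder Y] {f : X → Y}
    (hf : ∀ x y, f x ≤ y → ∃ x', x ≤ x' ∧ f x' = y) : IsBoundedOrderMap f := by
  rintro U hU _ y hy ⟨x, hx, rfl⟩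
  obtain ⟨x', h, rfl⟩ := hf x y hy
  exact ⟨x', hU h hx, rfl⟩

variable {X : Type*} [TopologicalSpace X] [CompactSpace X] [PartialOrder X] [OrderClosedTopology X]

theorem isClosed_coe_lowerClosure {K : Set X} (hK : IsClosed K) :
    IsClosed (lowerClosure K : Set X) := by
  have : (lowerClosure K : Set X) = Prod.fst '' ({p : X × X | p.1 ≤ p.2} ∩ Prod.snd ⁻¹' K) := by
    ext x
    simp [and_comm]
  rw [this]
  exact isClosedMap_fst_of_compactSpace _ (isClosed_le_prod.inter (hK.preimage continuous_snd))

theorem exists_isOpen_isUpperSet_notMem_closure {b z : X} (h : ¬ b ≤ z) :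
    ∃ U : Set X, IsOpen U ∧ IsUpperSet U ∧ b ∈ U ∧ z ∉ closure U := by
  have hz : (Set.Ici b)ᶜ ∈ nhds z := isClosed_Ici.isOpen_compl.mem_nhds h
  obtain ⟨W, hW, hWc, hWb⟩ := exists_mem_nhds_isClosed_subset hz
  refine ⟨(lowerClosure W : Set X)ᶜ, (isClosed_coe_lowerClosure hWc).isOpen_compl,
    (lowerClosure W).lower.compl, ?_, ?_⟩
  · rintro ⟨w, hw, hbw⟩
    exact hWb hw hbw
  · rw [closure_compl, Set.mem_compl_iff, not_not, mem_interior_iff_mem_nhds]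
    exact Filter.mem_of_superset hW subset_lowerClosure

theorem exists_le_isMax (x : X) : ∃ m, x ≤ m ∧ IsMax m := by
  obtain ⟨m, hxm, hm⟩ := zorn_le_nonempty₀ (Set.univ : Set X) (fun c _ hc y hy => by
    have : Nonempty c := ⟨⟨y, hy⟩⟩
    obtain ⟨ub, hub⟩ := IsCompact.nonempty_iInter_of_directed_nonempty_isCompact_isClosed
      (fun a : c => Set.Ici (a : X))
      (by
        rintro ⟨a, ha⟩ ⟨b, hb⟩
        rcases hc.total ha hb with h | h
        · exact ⟨⟨b, hb⟩, Set.Ici_subset_Ici.2 h, le_rfl⟩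
        · exact ⟨⟨a, ha⟩, le_rfl, Set.Ici_subset_Ici.2 h⟩)
      (fun a => ⟨a, le_rfl⟩) (fun a => isClosed_Ici.isCompact) (fun a => isClosed_Ici)
    exact ⟨ub, trivial, fun z hz => Set.mem_iInter.1 hub ⟨z, hz⟩⟩) x trivial
  exact ⟨m, hxm, fun y hy => hm.2 trivial hy⟩

end OrderTopology

section Types

variable {C : Type u} [Category.{v} C]

theorem KOrd.map_comp_apply (S : Cᵒᵖ ⥤ KOrd.{w}) {a b c : Cᵒᵖ} (f : a ⟶ b) (g : b ⟶ c)
    (x : S.obj a) : S.map (f ≫ g) x = S.map g (S.map f x) := by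
  rw [S.map_comp]; rfl

theorem KOrd.map_id_apply (S : Cᵒᵖ ⥤ KOrd.{w}) {a : Cᵒᵖ} (x : S.obj a) : S.map (𝟙 a) x = x := by
  rw [S.map_id]; rfl

theorem KOrd.naturality_apply {S P : Cᵒᵖ ⥤ KOrd.{w}} (τ : S ⟶ P) {a b : Cᵒᵖ} (f : a ⟶ b)
    (x : S.obj a) : τ.app b (S.map f x) = P.map f (τ.app a x) :=
  congrArg (fun h : S.obj a ⟶ P.obj b => h x) (τ.naturality f)

theorem KOrd.monotone_hom {X Y : KOrd.{w}} (f : X ⟶ Y) : Monotone f := f.hom.monotone'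

theorem KOrd.continuous_hom {X Y : KOrd.{w}} (f : X ⟶ Y) : Continuous f := f.hom.continuous_toFun

variable {S P : Cᵒᵖ ⥤ KOrd.{w}} {f : S ⟶ P}

/-- Extension of a pair of types with the same image along a pushout, realising a prescribed type
on the new side in the first coordinate. -/
theorem exists_extension_fst (hS : IsPolyadic S) (hf : IsIntuitionisticMorphism f)
    {k m M W : C} {σ : k ⟶ m} {ρ : k ⟶ M} {j : m ⟶ W} {i : M ⟶ W} (hW : IsPushout σ ρ j i)
    {x y : S.obj (op M)} (hxy : f.app (op M) x = f.app (op M) y) {b : S.obj (op m)}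
    (hb : S.map σ.op b ≤ S.map ρ.op x) :
    ∃ x' y' : S.obj (op W), f.app (op W) x' = f.app (op W) y' ∧ x ≤ S.map i.op x' ∧
      S.map i.op y' = y ∧ b ≤ S.map j.op x' := by
  obtain ⟨a, hba, hax⟩ := hS.interpolation hW b x hb
  obtain ⟨x₁, hax₁, rfl⟩ := (hS.bounded i).exists_le_map_eq hax
  obtain ⟨c, hc, hcy⟩ := hf.isPolyadicMorphism i (f.app (op W) x₁) y
    (by rw [← KOrd.naturality_apply, hxy])
  obtain ⟨y₁, hcy₁, rfl⟩ := (hS.bounded i).exists_le_map_eq hcy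
  obtain ⟨x₂, hx, hxy₂⟩ := (hf.bounded W).exists_le_map_eq
    (hc.trans (KOrd.monotone_hom (f.app (op W)) hcy₁))
  exact ⟨x₂, y₁, hxy₂, KOrd.monotone_hom _ hx, rfl,
    hba.trans (KOrd.monotone_hom _ (hax₁.trans hx))⟩

/-- Extension of a pair of types with the same image along a pushout, realising a prescribed type
on the new side in the second coordinate. -/
theorem exists_extension_snd (hS : IsPolyadic S) (hf : IsIntuitionisticMorphism f)
    {k m M W : C} {σ : k ⟶ m} {ρ : k ⟶ M} {j : m ⟶ W} {i : M ⟶ W} (hW : IsPushout σ ρ j i)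
    {x y : S.obj (op M)} (hxy : f.app (op M) x = f.app (op M) y) {b : S.obj (op m)}
    (hb : S.map σ.op b ≤ S.map ρ.op y) :
    ∃ x' y' : S.obj (op W), f.app (op W) x' = f.app (op W) y' ∧ x ≤ S.map i.op x' ∧
      S.map i.op y' = y ∧ b ≤ S.map j.op y' := by
  obtain ⟨a, hba, hay⟩ := hS.interpolation hW b y hb
  obtain ⟨y₁, hay₁, rfl⟩ := (hS.bounded i).exists_le_map_eq hay
  obtain ⟨c, hxc, hc⟩ := hf.interpolation_ge i x (f.app (op W) y₁)
    (by rw [← KOrd.naturality_apply, hxy])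
  obtain ⟨x₂, hx, hxy₂⟩ := (hf.bounded W).exists_le_map_eq hc
  exact ⟨x₂, y₁, hxy₂, hxc.trans (KOrd.monotone_hom _ hx), rfl,
    hba.trans (KOrd.monotone_hom _ hay₁)⟩

end Types

section Pairs

variable {C : Type u} [Category.{v} C] {S P : Cᵒᵖ ⥤ KOrd.{v}}

/-- The presheaf of pairs of elements of `S` with the same image under `f : S ⟶ P`. -/
def pairs (f : S ⟶ P) : Cᵒᵖ ⥤ Type v where
  obj n := {z : S.obj n × S.obj n // f.app n z.1 = f.app n z.2}
  map σ := ↾fun z => ⟨(S.map σ z.1.1, S.map σ z.1.2), by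
    rw [KOrd.naturality_apply, KOrd.naturality_apply, z.2]⟩
  map_id n := by
    ext z <;> exact KOrd.map_id_apply S _
  map_comp g h := by
    ext z <;> exact KOrd.map_comp_apply S _ _ _

variable {f : S ⟶ P}

/-- The first (`true`) and second (`false`) components of an element of `pairs f`. -/
def coord (s : Bool) {n : Cᵒᵖ} (z : (pairs f).obj n) : S.obj n := cond s z.1.1 z.1.2

theorem coord_ext {n : Cᵒᵖ} {z z' : (pairs f).obj n} (h : ∀ s, coord s z = coord s z') : z = z' :=
  Subtype.ext (Prod.ext (h true) (h false))

theorem app_coord {n : Cᵒᵖ} (z : (pairs f).obj n) :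
    f.app n (coord true z) = f.app n (coord false z) := z.2

theorem coord_map (s : Bool) {n m : Cᵒᵖ} (σ : n ⟶ m) (z : (pairs f).obj n) :
    coord s ((pairs f).map σ z) = S.map σ (coord s z) := by
  cases s <;> rfl

theorem coord_app_map (s : Bool) {X : Cᵒᵖ ⥤ Type v} (z : X ⟶ pairs f) {n m : Cᵒᵖ} (σ : n ⟶ m)
    (p : X.obj n) : coord s (z.app m (X.map σ p)) = S.map σ (coord s (z.app n p)) := by
  rw [NatTrans.naturality_apply, coord_map]

/-- `z'` has the same second component as `z` and a larger first component. -/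
def FstLE {X : Cᵒᵖ ⥤ Type v} (z z' : X ⟶ pairs f) : Prop :=
  ∀ n p, coord true (z.app n p) ≤ coord true (z'.app n p) ∧
    coord false (z'.app n p) = coord false (z.app n p)

/-- The first component is maximal among those compatible with the second component. -/
def IsFstMax {X : Cᵒᵖ ⥤ Type v} (z : X ⟶ pairs f) : Prop :=
  ∀ z' : X ⟶ pairs f, FstLE z z' → z' = z

theorem exists_fstLE_isFstMax {X : Cᵒᵖ ⥤ Type v} (z : X ⟶ pairs f) :
    ∃ z', FstLE z z' ∧ IsFstMax z' := by
  let A : Set (∀ i : Σ n, X.obj n, S.obj i.1) :=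
    {x | (∀ n m (σ : n ⟶ m) (p : X.obj n), x ⟨m, X.map σ p⟩ = S.map σ (x ⟨n, p⟩)) ∧
      ∀ i, f.app _ (x i) = f.app _ (coord false (z.app i.1 i.2))}
  have hA : IsClosed A := by
    refine IsClosed.and ?_ ?_
    · simp only [Set.ofPred_forall]
      exact isClosed_iInter fun n => isClosed_iInter fun m => isClosed_iInter fun σ =>
        isClosed_iInter fun p => isClosed_eq (continuous_apply _)
          ((KOrd.continuous_hom _).comp (continuous_apply _))
    · simp only [Set.ofPred_forall]
      exact isClosed_iInter fun i => isClosed_eq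
        ((KOrd.continuous_hom _).comp (continuous_apply _)) continuous_const
  have : CompactSpace A := isCompact_iff_compactSpace.1 hA.isCompact
  have : OrderClosedTopology A := ⟨isClosed_le_prod.preimage
    (continuous_subtype_val.prodMap continuous_subtype_val)⟩
  let toA (z' : X ⟶ pairs f) (h : FstLE z z') : A :=
    ⟨fun i => coord true (z'.app i.1 i.2), fun n m σ p => coord_app_map true z' σ p,
      fun i => by rw [app_coord, (h _ _).2]⟩
  let ofA (x : A) : X ⟶ pairs f :=
    { app := fun n => ↾fun p => ⟨(x.1 ⟨n, p⟩, coord false (z.app n p)), x.2.2 ⟨n, p⟩⟩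
      naturality := by
        intro n m σ
        ext p
        exact Subtype.ext (Prod.ext (x.2.1 n m σ p) (coord_app_map false z σ p)) }
  have hz : FstLE z z := fun n p => ⟨le_rfl, rfl⟩
  obtain ⟨x, hzx, hx⟩ := exists_le_isMax (toA z hz)
  have h₁ : FstLE z (ofA x) := fun n p => ⟨hzx ⟨n, p⟩, rfl⟩
  refine ⟨ofA x, h₁, fun z' hz' => ?_⟩
  have h₂ : FstLE z z' := fun n p => ⟨(h₁ n p).1.trans (hz' n p).1, (hz' n p).2⟩
  have h₃ := hx (b := toA z' h₂) fun i => (hz' i.1 i.2).1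
  ext n p
  refine coord_ext fun s => ?_
  cases s
  · exact (hz' n p).2
  · exact (h₃ ⟨n, p⟩).antisymm (hz' n p).1

/-- Ind-objects with a pair of structures whose first component is maximal. -/
def IsGood (f : S ⟶ P) : ObjectProperty (Over (pairs f)) :=
  fun Z => IsIndObject Z.left ∧ IsFstMax Z.hom

theorem IsFstMax.of_jointly_surjective {X : Cᵒᵖ ⥤ Type v} {z : X ⟶ pairs f} {I : Type*}
    {Y : I → Cᵒᵖ ⥤ Type v} (g : ∀ i, Y i ⟶ X) (hg : ∀ n (p : X.obj n), ∃ i q, (g i).app n q = p)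
    (h : ∀ i, IsFstMax (g i ≫ z)) : IsFstMax z := by
  intro z' hz'
  ext n p
  obtain ⟨i, q, rfl⟩ := hg n p
  have := h i (g i ≫ z') (fun n p => hz' n ((g i).app n p))
  exact congrArg (fun t => t.app n q) this

theorem Presheaf.exists_app_eq {J : Type v} [SmallCategory J] {F : J ⥤ Cᵒᵖ ⥤ Type v} {c : Cocone F}
    (hc : IsColimit c) (n : Cᵒᵖ) (p : c.pt.obj n) : ∃ j q, (c.ι.app j).app n q = p :=
  Types.jointly_surjective _ (isColimitOfPreserves ((evaluation _ _).obj n) hc) p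

instance isGood_isClosedUnderColimitsOfShape (J : Type v) [SmallCategory J] [IsFiltered J] :
    (IsGood f).IsClosedUnderColimitsOfShape J where
  colimitsOfShape_le := by
    rintro Z ⟨h⟩
    let c : Cocone (h.diag ⋙ Over.forget (pairs f)) := (Over.forget _).mapCocone h.cocone
    have hc : IsColimit c := isColimitOfPreserves (Over.forget _) h.isColimit
    refine ⟨?_, ?_⟩
    · let e : colimit (h.diag ⋙ Over.forget (pairs f)) ≅ Z.left :=
        colimit.isoColimitCocone ⟨c, hc⟩
      exact (isIndObject_colimit J (h.diag ⋙ Over.forget (pairs f))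
        fun j => (h.prop_diag_obj j).1).map e.hom
    · refine .of_jointly_surjective (fun j => (h.ι.app j).left) (Presheaf.exists_app_eq hc) ?_
      intro j
      have := Over.w (h.ι.app j)
      dsimp only [Functor.const_obj_obj] at this
      rw [this]
      exact (h.prop_diag_obj j).2

end Pairs

section OneStep

variable {C : Type u} [Category.{v} C] {S P : Cᵒᵖ ⥤ KOrd.{v}} {f : S ⟶ P}

/-- `b` is realised by a lift of `p` along `σ`, in the component `s`. -/
def Realizes {Y : Cᵒᵖ ⥤ Type v} (z : Y ⟶ pairs f) {k m : C} (σ : k ⟶ m) (p : Y.obj (op k))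
    (b : S.obj (op m)) (s : Bool) : Prop :=
  ∃ q : Y.obj (op m), Y.map σ.op q = p ∧ b ≤ coord s (z.app _ q)

theorem Realizes.map {X Y : Cᵒᵖ ⥤ Type v} {z : X ⟶ pairs f} {z' : Y ⟶ pairs f} (g : X ⟶ Y)
    (hg : g ≫ z' = z) {k m : C} {σ : k ⟶ m} {p : X.obj (op k)} {b : S.obj (op m)} {s : Bool}
    (h : Realizes z σ p b s) : Realizes z' σ (g.app _ p) b s := by
  subst hg
  obtain ⟨q, rfl, hb⟩ := h
  exact ⟨g.app _ q, (NatTrans.naturality_apply g _ _).symm, hb⟩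

theorem exists_extension (hS : IsPolyadic S) (hf : IsIntuitionisticMorphism f)
    {k m M W : C} {σ : k ⟶ m} {ρ : k ⟶ M} {j : m ⟶ W} {i : M ⟶ W} (hW : IsPushout σ ρ j i)
    (z : (pairs f).obj (op M)) {b : S.obj (op m)} {s : Bool}
    (hb : S.map σ.op b ≤ S.map ρ.op (coord s z)) :
    ∃ z' : (pairs f).obj (op W), coord true z ≤ S.map i.op (coord true z') ∧
      S.map i.op (coord false z') = coord false z ∧ b ≤ S.map j.op (coord s z') := by
  cases s
  · obtain ⟨x, y, h, h₁, h₂, h₃⟩ := exists_extension_snd hS hf hW z.2 hb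
    exact ⟨⟨(x, y), h⟩, h₁, h₂, h₃⟩
  · obtain ⟨x, y, h, h₁, h₂, h₃⟩ := exists_extension_fst hS hf hW z.2 hb
    exact ⟨⟨(x, y), h⟩, h₁, h₂, h₃⟩

/-- A cofiltered system of nonempty closed sets of pairs has a compatible family. -/
theorem exists_compatible_pairs {U : Type v} [SmallCategory U] [IsFiltered U] (G : U ⥤ C)
    (K : ∀ u, Set (S.obj (op (G.obj u)) × S.obj (op (G.obj u)))) (hK : ∀ u, IsClosed (K u))
    (hne : ∀ u, ∃ z : (pairs f).obj (op (G.obj u)), z.1 ∈ K u)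
    (hmap : ∀ u u' (g : u ⟶ u') (z : (pairs f).obj (op (G.obj u'))), z.1 ∈ K u' →
      ((pairs f).map (G.map g).op z).1 ∈ K u) :
    ∃ e : ∀ u, (pairs f).obj (op (G.obj u)), (∀ u, (e u).1 ∈ K u) ∧
      ∀ u u' (g : u ⟶ u'), (pairs f).map (G.map g).op (e u') = e u := by
  let Q (u : U) : Set (S.obj (op (G.obj u)) × S.obj (op (G.obj u))) :=
    {z | f.app _ z.1 = f.app _ z.2} ∩ K u
  have hQ (u) : IsClosed (Q u) := (isClosed_eq ((KOrd.continuous_hom _).comp continuous_fst)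
    ((KOrd.continuous_hom _).comp continuous_snd)).inter (hK u)
  let T : Uᵒᵖ ⥤ TopCat.{v} :=
    { obj := fun u => TopCat.of (Q u.unop)
      map := fun {u u'} g => TopCat.ofHom
        { toFun := fun z => ⟨((pairs f).map (G.map g.unop).op ⟨z.1, z.2.1⟩).1,
            ((pairs f).map (G.map g.unop).op ⟨z.1, z.2.1⟩).2, hmap _ _ g.unop ⟨z.1, z.2.1⟩ z.2.2⟩
          continuous_toFun := Continuous.subtype_mk (Continuous.prodMk
            ((KOrd.continuous_hom _).comp (continuous_fst.comp continuous_subtype_val))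
            ((KOrd.continuous_hom _).comp (continuous_snd.comp continuous_subtype_val))) _ }
      map_id := fun u => by
        refine ConcreteCategory.hom_ext _ _ fun z => Subtype.ext ?_
        have h : (pairs f).map (G.map (𝟙 u.unop)).op ⟨z.1, z.2.1⟩ = ⟨z.1, z.2.1⟩ := by
          rw [G.map_id, op_id, (pairs f).map_id]; rfl
        exact congrArg (fun t : (pairs f).obj _ => t.1) h
      map_comp := fun {u u' u''} g h => by
        refine ConcreteCategory.hom_ext _ _ fun z => Subtype.ext ?_
        have h : (pairs f).map (G.map (h.unop ≫ g.unop)).op ⟨z.1, z.2.1⟩ =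
            (pairs f).map (G.map h.unop).op
              ((pairs f).map (G.map g.unop).op ⟨z.1, z.2.1⟩) := by
          rw [G.map_comp, op_comp, (pairs f).map_comp]; rfl
        exact congrArg (fun t : (pairs f).obj _ => t.1) h }
  have (u : Uᵒᵖ) : Nonempty (T.obj u) := by
    obtain ⟨z, hz⟩ := hne u.unop
    exact ⟨⟨z.1, z.2, hz⟩⟩
  have (u : Uᵒᵖ) : CompactSpace (T.obj u) := isCompact_iff_compactSpace.1 (hQ u.unop).isCompact
  have (u : Uᵒᵖ) : T2Space (T.obj u) := inferInstanceAs (T2Space (Q u.unop))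
  obtain ⟨e, he⟩ := TopCat.nonempty_limitCone_of_compact_t2_cofiltered_system T
  exact ⟨fun u => ⟨(e (op u)).1, (e (op u)).2.1⟩, fun u => (e (op u)).2.2,
    fun u u' g => Subtype.ext (show (T.map g.op (e (op u'))).1 = (e (op u)).1 by rw [he])⟩

variable [HasPushouts C]

/-- Pushouts of a map `σ` along the transition maps of a diagram. -/
noncomputable def pushoutDiagram {I : Type v} [SmallCategory I] (F : I ⥤ C) {i₀ : I} {k m : C}
    (σ : k ⟶ m) (ρ : k ⟶ F.obj i₀) : Under i₀ ⥤ C where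
  obj u := pushout σ (ρ ≫ F.map u.hom)
  map {u u'} g := pushout.desc (pushout.inl _ _) (F.map g.right ≫ pushout.inr _ _) (by
    rw [pushout.condition, ← Under.w g, F.map_comp]; simp)
  map_id u := by ext <;> simp
  map_comp g h := by
    refine pushout.hom_ext ?_ ?_
    · rw [pushout.inl_desc, pushout.inl_desc_assoc, pushout.inl_desc]
    · rw [pushout.inr_desc, pushout.inr_desc_assoc, Category.assoc, pushout.inr_desc]
      simp

end OneStep

section OneStep

variable {C : Type u} [Category.{v} C] {S P : Cᵒᵖ ⥤ KOrd.{v}} {f : S ⟶ P}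
theorem FstLE.trans {X : Cᵒᵖ ⥤ Type v} {z z' z'' : X ⟶ pairs f} (h : FstLE z z')
    (h' : FstLE z' z'') : FstLE z z'' :=
  fun n p => ⟨(h n p).1.trans (h' n p).1, (h' n p).2.trans (h n p).2⟩

theorem FstLE.coord_le {X : Cᵒᵖ ⥤ Type v} {z z' : X ⟶ pairs f} (h : FstLE z z') (s : Bool)
    {n : Cᵒᵖ} (p : X.obj n) : coord s (z.app n p) ≤ coord s (z'.app n p) := by
  cases s
  · exact (h n p).2.ge
  · exact (h n p).1

variable [HasPushouts C]

/-- A single condition can be forced on a larger ind-object without changing the structure. -/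
theorem exists_good_realizes (hS : IsPolyadic S) (hf : IsIntuitionisticMorphism f)
    {X : Cᵒᵖ ⥤ Type v} (z : X ⟶ pairs f) (hX : IsIndObject X) (hz : IsFstMax z) {k m : C}
    (σ : k ⟶ m) (p : X.obj (op k)) (b : S.obj (op m)) (s : Bool)
    (hb : S.map σ.op b ≤ coord s (z.app _ p)) :
    ∃ (Y : Cᵒᵖ ⥤ Type v) (g : X ⟶ Y) (z' : Y ⟶ pairs f), IsIndObject Y ∧ IsFstMax z' ∧
      g ≫ z' = z ∧ Realizes z' σ (g.app _ p) b s := by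
  let R := hX.presentation
  obtain ⟨i₀, ρ, hρ⟩ := Presheaf.exists_app_eq R.coconeIsColimit (op k) p
  change k ⟶ R.F.obj i₀ at ρ
  let G : Under i₀ ⥤ C := pushoutDiagram R.F σ ρ
  let inl (u : Under i₀) : m ⟶ G.obj u := pushout.inl _ _
  let inr (u : Under i₀) : R.F.obj u.right ⟶ G.obj u := pushout.inr _ _
  have hpo (u : Under i₀) : IsPushout σ (ρ ≫ R.F.map u.hom) (inl u) (inr u) :=
    IsPushout.of_hasPushout _ _
  have inl_map {u u' : Under i₀} (g : u ⟶ u') : inl u ≫ G.map g = inl u' :=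
    pushout.inl_desc _ _ _
  have inr_map {u u' : Under i₀} (g : u ⟶ u') :
      inr u ≫ G.map g = R.F.map g.right ≫ inr u' :=
    pushout.inr_desc _ _ _
  let a (i : R.I) : (pairs f).obj (op (R.F.obj i)) :=
    z.app _ ((R.ι.app i).app (op (R.F.obj i)) (𝟙 (R.F.obj i)))
  let ι (i : R.I) : yoneda.obj (R.F.obj i) ⟶ X := R.ι.app i
  have ι_app (i : R.I) {n : C} (r : n ⟶ R.F.obj i) :
      z.app _ ((ι i).app (op n) r) = (pairs f).map r.op (a i) := by
    rw [← NatTrans.naturality_apply, ← NatTrans.naturality_apply]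
    congr 2
    exact (Category.comp_id r).symm
  have ι_map {i i' : R.I} (g : i ⟶ i') : yoneda.map (R.F.map g) ≫ ι i' = ι i := R.cocone.w g
  have a_map {i i' : R.I} (g : i ⟶ i') : (pairs f).map (R.F.map g).op (a i') = a i := by
    rw [← ι_app, ← Category.id_comp (R.F.map g)]
    exact congrArg (fun t => z.app _ (t.app _ (𝟙 _))) (ι_map g)
  have S_inr {u u' : Under i₀} (g : u ⟶ u') (x) : S.map (inr u).op (S.map (G.map g).op x) =
      S.map (R.F.map g.right).op (S.map (inr u').op x) := by
    rw [← KOrd.map_comp_apply, ← KOrd.map_comp_apply, ← op_comp, ← op_comp, inr_map]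
  have S_inl {u u' : Under i₀} (g : u ⟶ u') (x) : S.map (inl u).op (S.map (G.map g).op x) =
      S.map (inl u').op x := by
    rw [← KOrd.map_comp_apply, ← op_comp, inl_map]
  let K (u : Under i₀) : Set (S.obj (op (G.obj u)) × S.obj (op (G.obj u))) :=
    {e | coord true (a u.right) ≤ S.map (inr u).op e.1 ∧
      S.map (inr u).op e.2 = coord false (a u.right) ∧ b ≤ S.map (inl u).op (cond s e.1 e.2)}
  obtain ⟨e, heK, he⟩ := exists_compatible_pairs (f := f) G K
    (by
      intro u
      refine (isClosed_le continuous_const ((KOrd.continuous_hom _).comp continuous_fst)).inter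
        ((isClosed_eq ((KOrd.continuous_hom _).comp continuous_snd) continuous_const).inter
          (isClosed_le continuous_const ((KOrd.continuous_hom _).comp ?_)))
      cases s
      · exact continuous_snd
      · exact continuous_fst)
    (by
      intro u
      obtain ⟨e, h⟩ := exists_extension hS hf (hpo u) (a u.right) (b := b) (s := s) (by
        refine hb.trans_eq ?_
        rw [← coord_map, op_comp, Functor.map_comp_apply, a_map, ← ι_app]
        exact congrArg (fun t => coord s (z.app _ t)) hρ.symm)
      exact ⟨e, h⟩)
    (by
      rintro u u' g e ⟨h₁, h₂, h₃⟩
      refine ⟨?_, ?_, ?_⟩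
      · refine le_of_le_of_eq ?_ (S_inr g _).symm
        rw [← a_map g.right, coord_map]
        exact KOrd.monotone_hom _ h₁
      · refine (S_inr g _).trans ?_
        rw [← a_map g.right, coord_map]
        exact congrArg _ h₂
      · refine h₃.trans_eq ?_
        rw [← S_inl g]
        cases s <;> rfl)
  let Y := colimit (G ⋙ yoneda)
  let κ (u : Under i₀) : yoneda.obj (G.obj u) ⟶ Y := colimit.ι (G ⋙ yoneda) u
  have κ_w {u u' : Under i₀} (g : u ⟶ u') : yoneda.map (G.map g) ≫ κ u' = κ u :=
    colimit.w (G ⋙ yoneda) g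
  have κ_inr {u u' : Under i₀} (g : u ⟶ u') :
      yoneda.map (R.F.map g.right) ≫ yoneda.map (inr u') ≫ κ u' = yoneda.map (inr u) ≫ κ u := by
    rw [← κ_w g, ← yoneda.map_comp_assoc, ← yoneda.map_comp_assoc, inr_map]
  let z₀ : Y ⟶ pairs f := colimit.desc (G ⋙ yoneda)
    { pt := pairs f
      ι := { app := fun u => yonedaEquiv.symm (e u)
             naturality := fun u u' g => by
              rw [← he u u' g]
              exact (yonedaEquiv_symm_naturality_left _ _ _).trans (Category.comp_id _).symm } }
  have hz₀ (u : Under i₀) {n : C} (r : n ⟶ G.obj u) :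
      z₀.app _ ((κ u).app (op n) r) = (pairs f).map r.op (e u) := by
    have h : κ u ≫ z₀ = yonedaEquiv.symm (e u) := colimit.ι_desc _ u
    have h' := congrArg (fun t => t.app (op n) r) h
    exact h'.trans (yonedaEquiv_symm_app_apply (e u) (op n) r)
  let c := Cocone.whisker (Under.forget i₀) R.cocone
  have hc : IsColimit c := (Functor.Final.isColimitWhiskerEquiv _ _).symm R.coconeIsColimit
  let g : X ⟶ Y := hc.desc
    { pt := Y
      ι := { app := fun u => yoneda.map (inr u) ≫ κ u
             naturality := fun u u' g =>
              (κ_inr g).trans (Category.comp_id _).symm } }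
  have hg (u : Under i₀) {n : C} (r : n ⟶ R.F.obj u.right) :
      g.app _ ((ι u.right).app (op n) r) = (κ u).app (op n) (r ≫ inr u) := by
    have h : ι u.right ≫ g = yoneda.map (inr u) ≫ κ u := hc.fac _ u
    exact congrArg (fun t => t.app (op n) r) h
  obtain ⟨z', hz', hmax⟩ := exists_fstLE_isFstMax z₀
  have hle : FstLE z (g ≫ z₀) := by
    rintro ⟨n⟩ q
    obtain ⟨u, r, rfl⟩ := Presheaf.exists_app_eq hc (op n) q
    change n ⟶ R.F.obj u.right at r
    have h₁ : z.app (op n) ((c.ι.app u).app (op n) r) = (pairs f).map r.op (a u.right) :=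
      ι_app u.right r
    have h₂ : (g ≫ z₀).app (op n) ((c.ι.app u).app (op n) r) =
        (pairs f).map r.op ((pairs f).map (inr u).op (e u)) := by
      refine (congrArg (fun t => z₀.app (op n) t) (hg u r)).trans ?_
      rw [hz₀, op_comp, Functor.map_comp_apply]
    rw [h₁, h₂, coord_map, coord_map, coord_map, coord_map]
    exact ⟨KOrd.monotone_hom _ (heK u).1, congrArg _ (heK u).2.1⟩
  refine ⟨Y, g, z', isIndObject_colimit _ _ fun u => isIndObject_yoneda _, hmax,
    hz _ (hle.trans fun n p => hz' n (g.app n p)), ?_⟩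
  let u₀ : Under i₀ := Under.mk (𝟙 i₀)
  refine ⟨(κ u₀).app (op m) (inl u₀), ?_, ?_⟩
  · rw [← hρ]
    refine Eq.trans ?_ (hg u₀ ρ).symm
    rw [← NatTrans.naturality_apply]
    refine congrArg (fun t => (κ u₀).app (op k) t) ?_
    have := (hpo u₀).w
    simpa [u₀] using this
  · refine le_trans ?_ (hz'.coord_le s _)
    rw [hz₀, coord_map]
    exact (heK u₀).2.2

end OneStep

section Saturation

variable {C : Type u} [Category.{v} C] {S P : Cᵒᵖ ⥤ KOrd.{v}} {f : S ⟶ P}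

theorem Realizes.of_iso {X : Cᵒᵖ ⥤ Type v} {z : X ⟶ pairs f} {k m k' m' : C} (α : k' ≅ k)
    (β : m' ≅ m) {σ : k ⟶ m} {p : X.obj (op k)} {b : S.obj (op m)} {s : Bool}
    (h : Realizes z (α.hom ≫ σ ≫ β.inv) (X.map α.hom.op p) (S.map β.hom.op b) s) :
    Realizes z σ p b s := by
  obtain ⟨q, hq, hb⟩ := h
  refine ⟨X.map β.inv.op q, ?_, ?_⟩
  · have := congrArg (X.map α.inv.op) hq
    simpa [← Functor.map_comp_apply, ← op_comp] using this
  · rw [coord_app_map]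
    refine le_of_eq_of_le ?_ (KOrd.monotone_hom (S.map β.inv.op) hb)
    rw [← KOrd.map_comp_apply, ← op_comp, β.inv_hom_id]
    exact (KOrd.map_id_apply S b).symm

theorem exists_hom_realizes_all [EssentiallySmall.{v} C] [HasPushouts C] (hS : IsPolyadic S)
    (hf : IsIntuitionisticMorphism f) (Z : (IsGood f).FullSubcategory) :
    ∃ (Z' : (IsGood f).FullSubcategory) (g : Z ⟶ Z'), ∀ {k m : C} (σ : k ⟶ m)
      (p : Z.obj.left.obj (op k)) (b : S.obj (op m)) (s : Bool),
      S.map σ.op b ≤ coord s (Z.obj.hom.app _ p) →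
        Realizes Z'.obj.hom σ (g.hom.left.app _ p) b s := by
  let e := (equivSmallModel.{v} C).inverse
  let T : Type v := Σ (k m : SmallModel.{v} C) (_ : e.obj k ⟶ e.obj m)
    (_ : Z.obj.left.obj (op (e.obj k))) (_ : S.obj (op (e.obj m))), Bool
  let forces (Y : Under Z) : T → Prop := fun ⟨_, _, σ, p, b, s⟩ =>
    S.map σ.op b ≤ coord s (Z.obj.hom.app _ p) →
      Realizes Y.right.obj.hom σ (Y.hom.hom.left.app _ p) b s
  obtain ⟨Y, -, hY⟩ := exists_hom_forcing_all forces
    (by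
      rintro Y Y' g ⟨k, m, σ, p, b, s⟩ h hb
      have h' := (h hb).map g.right.hom.left (Over.w g.right.hom)
      have hw : Y.hom.hom.left ≫ g.right.hom.left = Y'.hom.hom.left :=
        congrArg (fun t => t.hom.left) (Under.w g)
      rw [← hw]
      exact h')
    (by
      rintro Y ⟨k, m, σ, p, b, s⟩
      by_cases hb : S.map σ.op b ≤ coord s (Z.obj.hom.app _ p)
      · have hw : Y.hom.hom.left ≫ Y.right.obj.hom = Z.obj.hom := Over.w Y.hom.hom
        obtain ⟨X, g, z', hX, hz', hg, h⟩ := exists_good_realizes hS hf Y.right.obj.hom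
          Y.right.property.1 Y.right.property.2 σ (Y.hom.hom.left.app _ p) b s (by
            rw [← hw] at hb
            exact hb)
        let Y₁ : (IsGood f).FullSubcategory := ⟨Over.mk z', hX, hz'⟩
        let g₁ : Y.right ⟶ Y₁ := ObjectProperty.homMk (Over.homMk g hg)
        exact ⟨Under.mk (Y.hom ≫ g₁), ⟨Under.homMk g₁⟩, fun _ => h⟩
      · exact ⟨Y, ⟨𝟙 Y⟩, fun h => (hb h).elim⟩)
    (fun J _ _ => hasColimitsOfShape_under Z) (Under.mk (𝟙 Z))
  refine ⟨Y.right, Y.hom, fun {k m} σ p b s hb => ?_⟩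
  let α : e.obj ((equivSmallModel.{v} C).functor.obj k) ≅ k :=
    (equivSmallModel.{v} C).unitIso.symm.app k
  let β : e.obj ((equivSmallModel.{v} C).functor.obj m) ≅ m :=
    (equivSmallModel.{v} C).unitIso.symm.app m
  refine Realizes.of_iso α β ?_
  have hn : Y.right.obj.left.map α.hom.op (Y.hom.hom.left.app _ p) =
      Y.hom.hom.left.app _ (Z.obj.left.map α.hom.op p) := (NatTrans.naturality_apply _ _ _).symm
  rw [hn]
  refine hY ⟨_, _, α.hom ≫ σ ≫ β.inv, Z.obj.left.map α.hom.op p, S.map β.hom.op b, s⟩ ?_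
  rw [coord_app_map, ← KOrd.map_comp_apply, ← op_comp]
  refine le_of_eq_of_le ?_ (KOrd.monotone_hom (S.map α.hom.op) hb)
  rw [← KOrd.map_comp_apply, ← op_comp]
  simp

/-- Every type compatible with an element of the ind-object is realised. -/
def IsSaturated {X : Cᵒᵖ ⥤ Type v} (z : X ⟶ pairs f) : Prop :=
  ∀ {k m : C} (σ : k ⟶ m) (p : X.obj (op k)) (b : S.obj (op m)) (s : Bool),
    S.map σ.op b ≤ coord s (z.app _ p) → Realizes z σ p b s

theorem exists_isSaturated [EssentiallySmall.{v} C] [HasPushouts C] (hS : IsPolyadic S)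
    (hf : IsIntuitionisticMorphism f) (Z : (IsGood f).FullSubcategory) :
    ∃ (Z' : (IsGood f).FullSubcategory) (_ : Z ⟶ Z'), IsSaturated Z'.obj.hom := by
  choose next toNext hnext using exists_hom_realizes_all hS hf
  let A (i : ℕ) : (IsGood f).FullSubcategory := Nat.rec Z (fun _ Y => next Y) i
  let F₀ : ℕ ⥤ (IsGood f).FullSubcategory := Functor.ofSequence (X := A) fun i => toNext (A i)
  let F : ULift.{v} ℕ ⥤ (IsGood f).FullSubcategory :=
    Monotone.functor (f := ULift.down) (fun _ _ h => h) ⋙ F₀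
  let c := colimit.cocone F
  refine ⟨c.pt, c.ι.app ⟨0⟩, fun {k m} σ p b s hb => ?_⟩
  obtain ⟨⟨i⟩, q, rfl⟩ := Presheaf.exists_app_eq
    (isColimitOfPreserves ((IsGood f).ι ⋙ Over.forget _) (colimit.isColimit F)) _ p
  let ι (i : ℕ) : A i ⟶ c.pt := c.ι.app ⟨i⟩
  have hι (i : ℕ) : (ι i).hom.left ≫ c.pt.obj.hom = (A i).obj.hom := Over.w (ι i).hom
  have hw : toNext (A i) ≫ ι (i + 1) = ι i := by
    have h : F.map (homOfLE (show (⟨i⟩ : ULift.{v} ℕ) ≤ ⟨i + 1⟩ from Nat.le_succ i)) =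
        toNext (A i) := Functor.ofSequence_map_homOfLE_succ (fun i => toNext (A i)) i
    rw [← h]
    exact c.w _
  change (A i).obj.left.obj (op k) at q
  change Realizes c.pt.obj.hom σ ((ι i).hom.left.app _ q) b s
  have h : Realizes (A (i + 1)).obj.hom σ ((toNext (A i)).hom.left.app _ q) b s := by
    refine hnext (A i) σ q b s ?_
    rw [← hι i]
    exact hb
  have h' := h.map (ι (i + 1)).hom.left (hι (i + 1))
  rw [← hw]
  exact h'

end Saturation

section BetaExtension

variable {C : Type u} [Category.{v} C] {S : Cᵒᵖ ⥤ KOrd.{v}} {X : Cᵒᵖ ⥤ Type v}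

theorem betaFunctor_hom_ext {x y : X ⋙ betaFunctor ⟶ S}
    (h : ∀ (n : Cᵒᵖ) (p : X.obj n),
      x.app n (pure p : Ultrafilter (X.obj n)) = y.app n (pure p : Ultrafilter (X.obj n))) :
    x = y := by
  refine NatTrans.ext (funext fun n => KOrd.Hom.ext (ContinuousOrderHom.ext fun t => ?_))
  exact congrFun (denseRange_pure.equalizer (f := pure (f := Ultrafilter) (α := X.obj n))
    (KOrd.continuous_hom (x.app n)) (KOrd.continuous_hom (y.app n)) (funext (h n))) t

/-- The extension to Stone–Čech compactifications of a natural family of maps. -/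
noncomputable def betaExtension (x : ∀ n, X.obj n → S.obj n)
    (hx : ∀ (n m : Cᵒᵖ) (σ : n ⟶ m) (p : X.obj n), x m (X.map σ p) = S.map σ (x n p)) :
    X ⋙ betaFunctor ⟶ S where
  app n := ⟨{ toFun := Ultrafilter.extend (x n)
              monotone' := fun _ _ h => le_of_eq (congrArg _ h)
              continuous_toFun := continuous_ultrafilter_extend (x n) }⟩
  naturality n m σ := by
    refine KOrd.Hom.ext (ContinuousOrderHom.ext fun t => ?_)
    refine congrFun (denseRange_pure.equalizer (f := pure (f := Ultrafilter) (α := X.obj n))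
      (g := fun t => Ultrafilter.extend (x m) (t.map (X.map σ)))
      (h := fun t => S.map σ (Ultrafilter.extend (x n) t))
      ((continuous_ultrafilter_extend (x m)).comp (BetaSet.continuous_ultrafilter_map _))
      ((KOrd.continuous_hom (S.map σ)).comp (continuous_ultrafilter_extend (x n)))
      (funext fun p => ?_)) t
    have h (n) (p : X.obj n) : Ultrafilter.extend (x n) (pure p) = x n p :=
      congrFun (ultrafilter_extend_extends (x n)) p
    simp only [Function.comp_apply, Ultrafilter.map_pure, h, hx]

variable {x : ∀ n, X.obj n → S.obj n}
  {hx : ∀ (n m : Cᵒᵖ) (σ : n ⟶ m) (p : X.obj n), x m (X.map σ p) = S.map σ (x n p)}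

theorem betaExtension_app_pure (n : Cᵒᵖ) (p : X.obj n) :
    (betaExtension x hx).app n (pure p : Ultrafilter (X.obj n)) = x n p :=
  congrFun (ultrafilter_extend_extends (x n)) p

theorem betaExtension_map_le (n : Cᵒᵖ) (t : Ultrafilter (X.obj n)) :
    ((t.map (x n) : Ultrafilter _) : Filter (S.obj n)) ≤ nhds ((betaExtension x hx).app n t) :=
  ultrafilter_extend_eq_iff.1 rfl

theorem betaExtension_isPolyadicMorphism (hS : IsOpenPolyadic S)
    (h : ∀ {k m : C} (σ : k ⟶ m) (p : X.obj (op k)) (b : S.obj (op m)),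
      S.map σ.op b ≤ x _ p → ∃ q, X.map σ.op q = p ∧ b ≤ x _ q) :
    IsPolyadicMorphism (betaExtension x hx) := by
  intro n m σ b c hb
  change Ultrafilter (X.obj (op n)) at c
  let B : Set (Set (S.obj (op m))) := {U | IsOpen U ∧ IsUpperSet U ∧ b ∈ U}
  let N : Filter (S.obj (op m)) := ⨅ U ∈ B, Filter.principal U
  have hN : N.HasBasis (· ∈ B) id := Filter.hasBasis_biInf_principal
    (fun U hU V hV => ⟨U ∩ V, ⟨hU.1.inter hV.1, hU.2.1.inter hV.2.1, hU.2.2, hV.2.2⟩,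
      Set.inter_subset_left, Set.inter_subset_right⟩)
    ⟨Set.univ, isOpen_univ, isUpperSet_univ, trivial⟩
  let F : Filter (X.obj (op m)) := N.comap (x (op m))
  have hF : (c : Filter (X.obj (op n))) ≤ F.map (X.map σ.op) := by
    refine ((hN.comap _).map _).ge_iff.2 fun U hU => ?_
    have hV := hS σ U hU.1 hU.2.1
    have hc : S.map σ.op '' U ∈ c.map (x (op n)) :=
      betaExtension_map_le (hx := hx) _ c
        (hV.1.mem_nhds (hV.2 hb ⟨b, hU.2.2, rfl⟩))
    refine Filter.mem_of_superset hc ?_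
    rintro p ⟨b', hb', hp⟩
    obtain ⟨q, hq, hbq⟩ := h σ p b' hp.le
    exact ⟨q, hU.2.1 hbq hb', hq⟩
  have hne : (F ⊓ (c : Filter _).comap (X.map σ.op)).NeBot := by
    rw [← Filter.map_neBot_iff (X.map σ.op), Filter.push_pull, inf_eq_right.2 hF]
    exact c.neBot
  let t := Ultrafilter.of (F ⊓ (c : Filter _).comap (X.map σ.op))
  have ht : (t : Filter _) ≤ F ⊓ (c : Filter _).comap (X.map σ.op) := Ultrafilter.of_le _
  refine ⟨t, ?_, ?_⟩
  · by_contra hbt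
    obtain ⟨U, hU, hU', hbU, hz⟩ := exists_isOpen_isUpperSet_notMem_closure hbt
    refine hz (mem_closure_iff_ultrafilter.2 ⟨t.map (x (op m)), ?_, betaExtension_map_le _ t⟩)
    exact ht.trans inf_le_left (Filter.preimage_mem_comap (hN.mem_of_mem ⟨hU, hU', hbU⟩))
  · exact Ultrafilter.eq_of_le (Filter.map_le_iff_le_comap.2 (ht.trans inf_le_right))

end BetaExtension

section Embedding

variable {C : Type u} [Category.{v} C] [EssentiallySmall.{v} C] [HasPushouts C]
  {S P : Cᵒᵖ ⥤ KOrd.{v}} {f : S ⟶ P}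

theorem IsIntuitionisticMorphism.le_of_app_le (hS : IsPolyadic S) (hSo : IsOpenPolyadic S)
    (hf : IsIntuitionisticMorphism f) (hinj : InjectiveOnModels f) {n : C} {x y : S.obj (op n)}
    (hxy : f.app (op n) x ≤ f.app (op n) y) : x ≤ y := by
  obtain ⟨x', hx, hxy'⟩ := (hf.bounded n).exists_le_map_eq hxy
  obtain ⟨z₀, hz₀, hmax⟩ := exists_fstLE_isFstMax
    (yonedaEquiv.symm (⟨(x', y), hxy'⟩ : (pairs f).obj (op n)))
  obtain ⟨Z, g, hZ⟩ := exists_isSaturated hS hf ⟨Over.mk z₀, isIndObject_yoneda n, hmax⟩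
  let X := Z.obj.left
  let z : X ⟶ pairs f := Z.obj.hom
  have hg : g.hom.left ≫ z = z₀ := Over.w g.hom
  let m (s : Bool) : X ⋙ betaFunctor ⟶ S :=
    betaExtension (fun n p => coord s (z.app n p)) fun n m σ p => coord_app_map s z σ p
  have hmp (s : Bool) (n) (p : X.obj n) :
      (m s).app n (pure p : Ultrafilter (X.obj n)) = coord s (z.app n p) :=
    betaExtension_app_pure n p
  have hm (s : Bool) : IsModelOfSpace (m s) :=
    ⟨Z.property.1, betaExtension_isPolyadicMorphism (x := fun n p => coord s (z.app n p)) hSo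
      fun σ p b hb => hZ σ p b s hb⟩
  have heq : m true = m false := by
    refine hinj X _ _ (hm true) (hm false) (betaFunctor_hom_ext fun n p => ?_)
    have h (s) : (m s ≫ f).app n (pure p : Ultrafilter (X.obj n)) =
        f.app n (coord s (z.app n p)) := congrArg (f.app n) (hmp s n p)
    rw [h, h, app_coord]
  let p : (yoneda.obj n).obj (op n) := 𝟙 n
  let q : X.obj (op n) := g.hom.left.app _ p
  have hq : z.app _ q = z₀.app _ p := congrArg (fun t => t.app (op n) p) hg
  have h : (m true).app _ (pure q : Ultrafilter (X.obj _)) =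
      (m false).app _ (pure q : Ultrafilter (X.obj _)) := by rw [heq]
  rw [hmp, hmp, hq] at h
  let e : (pairs f).obj (op n) := ⟨(x', y), hxy'⟩
  have hp₀ : (yonedaEquiv.symm e).app (op n) p = e := yonedaEquiv.apply_symm_apply e
  have h₁ := hz₀ _ p
  rw [hp₀] at h₁
  exact (hx.trans h₁.1).trans (h.trans h₁.2).le

theorem IsIntuitionisticMorphism.isPointwiseEmbedding (hS : IsPolyadic S) (hSo : IsOpenPolyadic S)
    (hf : IsIntuitionisticMorphism f) (hinj : InjectiveOnModels f) : IsPointwiseEmbedding f := by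
  intro n
  have h (x y : S.obj (op n)) : f.app (op n) x ≤ f.app (op n) y ↔ x ≤ y :=
    ⟨hf.le_of_app_le hS hSo hinj, fun h => KOrd.monotone_hom _ h⟩
  exact ⟨h, ((KOrd.continuous_hom _).isClosedEmbedding fun x y hxy =>
    ((h x y).1 hxy.le).antisymm ((h y x).1 hxy.ge)).isEmbedding⟩

end Embedding

section Duality

instance : OrderClosedTopology Bool := ⟨isClosed_discrete _⟩

/-- Prime filters of a bounded distributive lattice, as characteristic functions. -/
def PrimeFilters (A : Type w) [DistribLattice A] [BoundedOrder A] : Type w :=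
  {F : A → Bool // F ⊤ = true ∧ F ⊥ = false ∧ (∀ a b, F (a ⊓ b) = (F a && F b)) ∧
    ∀ a b, F (a ⊔ b) = (F a || F b)}

namespace PrimeFilters

section Lattice

variable {A : Type*} [DistribLattice A] [BoundedOrder A]

instance : TopologicalSpace (PrimeFilters A) := instTopologicalSpaceSubtype

instance : PartialOrder (PrimeFilters A) := Subtype.partialOrder _

instance : SetLike (PrimeFilters A) A where
  coe F := {a | F.1 a = true}
  coe_injective F G h := Subtype.ext (funext fun a => by
    have := Set.ext_iff.1 h a
    exact Bool.eq_iff_iff.2 this)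

theorem mem_iff {F : PrimeFilters A} {a : A} : a ∈ F ↔ F.1 a = true := Iff.rfl

theorem le_iff {F G : PrimeFilters A} : F ≤ G ↔ ∀ a, a ∈ F → a ∈ G := by
  refine forall_congr' fun a => ?_
  simp only [mem_iff]
  exact Bool.le_iff_imp

theorem continuous_apply (a : A) : Continuous fun F : PrimeFilters A => F.1 a :=
  (_root_.continuous_apply a).comp continuous_subtype_val

instance : CompactSpace (PrimeFilters A) := by
  refine isCompact_iff_compactSpace.1 (IsClosed.isCompact ?_)
  have h (a : A) : Continuous fun F : A → Bool => F a := _root_.continuous_apply a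
  refine (isClosed_eq (h _) continuous_const).and ((isClosed_eq (h _) continuous_const).and
    (IsClosed.and ?_ ?_))
  · simp only [Set.ofPred_forall]
    exact isClosed_iInter fun a => isClosed_iInter fun b => isClosed_eq (h _)
      (continuous_of_discreteTopology.comp ((h a).prodMk (h b)) :
        Continuous ((fun p : Bool × Bool => p.1 && p.2) ∘ fun F : A → Bool => (F a, F b)))
  · simp only [Set.ofPred_forall]
    exact isClosed_iInter fun a => isClosed_iInter fun b => isClosed_eq (h _)
      (continuous_of_discreteTopology.comp ((h a).prodMk (h b)) :
        Continuous ((fun p : Bool × Bool => p.1 || p.2) ∘ fun F : A → Bool => (F a, F b)))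

instance : OrderClosedTopology (PrimeFilters A) :=
  ⟨isClosed_le_prod.preimage (continuous_subtype_val.prodMap continuous_subtype_val)⟩

theorem isOpen_mem (a : A) : IsOpen {F : PrimeFilters A | a ∈ F} :=
  (isOpen_discrete {true}).preimage (continuous_apply a)

theorem isClosed_mem (a : A) : IsClosed {F : PrimeFilters A | a ∈ F} :=
  (isClosed_discrete {true}).preimage (continuous_apply a)

variable (F : PrimeFilters A)

theorem top_mem : ⊤ ∈ F := F.2.1

theorem bot_notMem : ⊥ ∉ F := by simp [mem_iff, F.2.2.1]

theorem inf_mem_iff {a b : A} : a ⊓ b ∈ F ↔ a ∈ F ∧ b ∈ F := by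
  simp [mem_iff, F.2.2.2.1]

theorem sup_mem_iff {a b : A} : a ⊔ b ∈ F ↔ a ∈ F ∨ b ∈ F := by
  simp [mem_iff, F.2.2.2.2]

variable {F} in
theorem mem_of_le {a b : A} (h : a ≤ b) (ha : a ∈ F) : b ∈ F := by
  rw [← inf_eq_left.2 h, inf_mem_iff] at ha
  exact ha.2

/-- A filter base and an ideal base that do not meet are separated by a prime filter. -/
theorem exists_separating {Φ Ψ : Set A} (hΦ : ⊤ ∈ Φ) (hΦ' : ∀ a ∈ Φ, ∀ b ∈ Φ, a ⊓ b ∈ Φ)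
    (hΨ : ⊥ ∈ Ψ) (hΨ' : ∀ a ∈ Ψ, ∀ b ∈ Ψ, a ⊔ b ∈ Ψ) (h : ∀ a ∈ Φ, ∀ b ∈ Ψ, ¬ a ≤ b) :
    ∃ F : PrimeFilters A, (∀ a ∈ Φ, a ∈ F) ∧ ∀ b ∈ Ψ, b ∉ F := by
  classical
  have hf : Order.IsPFilter {x : A | ∃ a ∈ Φ, a ≤ x} := by
    refine Order.IsPFilter.of_def ⟨⊤, ⊤, hΦ, le_rfl⟩ ?_ ?_
    · rintro x ⟨a, ha, hax⟩ y ⟨b, hb, hby⟩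
      exact ⟨a ⊓ b, ⟨a ⊓ b, hΦ' a ha b hb, le_rfl⟩, inf_le_left.trans hax, inf_le_right.trans hby⟩
    · rintro x y hxy ⟨a, ha, hax⟩
      exact ⟨a, ha, hax.trans hxy⟩
  have hi : Order.IsIdeal {x : A | ∃ b ∈ Ψ, x ≤ b} :=
    { IsLowerSet := by
        rintro x y hxy ⟨b, hb, hyb⟩
        exact ⟨b, hb, hxy.trans hyb⟩
      Nonempty := ⟨⊥, ⊥, hΨ, le_rfl⟩
      Directed := by
        rintro x ⟨a, ha, hax⟩ y ⟨b, hb, hby⟩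
        exact ⟨a ⊔ b, ⟨a ⊔ b, hΨ' a ha b hb, le_rfl⟩, hax.trans le_sup_left,
          hby.trans le_sup_right⟩ }
  obtain ⟨J, hJ, hIJ, hFJ⟩ := DistribLattice.prime_ideal_of_disjoint_filter_ideal
    (F := hf.toPFilter) (I := hi.toIdeal) (Set.disjoint_left.2 (by
      rintro x ⟨a, ha, hax⟩ ⟨b, hb, hxb⟩
      exact h a ha b hb (hax.trans hxb)))
  have hΦJ : ∀ a ∈ Φ, a ∉ J := fun a ha => Set.disjoint_left.1 hFJ ⟨a, ha, le_rfl⟩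
  have hΨJ : ∀ b ∈ Ψ, b ∈ J := fun b hb => hIJ ⟨b, hb, le_rfl⟩
  refine ⟨⟨fun a => decide (a ∉ J), ?_, ?_, ?_, ?_⟩, ?_, ?_⟩
  · simpa using hΦJ _ hΦ
  · simp
  · intro a b
    rw [← Bool.decide_and, decide_eq_decide]
    refine ⟨fun hab => ⟨fun ha => hab (J.lower inf_le_left ha),
      fun hb => hab (J.lower inf_le_right hb)⟩, fun hab hh => ?_⟩
    exact (hJ.mem_or_mem hh).elim hab.1 hab.2
  · intro a b
    rw [← Bool.decide_or, decide_eq_decide, Order.Ideal.sup_mem_iff, not_and_or]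
  · intro a ha
    exact decide_eq_true (hΦJ a ha)
  · intro b hb hbF
    exact of_decide_eq_true hbF (hΨJ b hb)

theorem exists_mem_subset {U : Set (PrimeFilters A)} (hU : IsOpen U) (hU' : IsUpperSet U)
    {F : PrimeFilters A} (hF : F ∈ U) : ∃ d ∈ F, ∀ G : PrimeFilters A, d ∈ G → G ∈ U := by
  by_contra! h
  obtain ⟨G, hG⟩ := IsCompact.nonempty_iInter_of_directed_nonempty_isCompact_isClosed
    (ι := {d // d ∈ F}) (hι := ⟨⟨⊤, F.top_mem⟩⟩)
    (fun d => {G : PrimeFilters A | d.1 ∈ G} ∩ Uᶜ)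
    (by
      rintro ⟨a, ha⟩ ⟨b, hb⟩
      refine ⟨⟨a ⊓ b, F.inf_mem_iff.2 ⟨ha, hb⟩⟩, ?_, ?_⟩
      · rintro G ⟨hG, hGU⟩
        exact ⟨(G.inf_mem_iff.1 hG).1, hGU⟩
      · rintro G ⟨hG, hGU⟩
        exact ⟨(G.inf_mem_iff.1 hG).2, hGU⟩)
    (fun d => h d.1 d.2)
    (fun d => ((isClosed_mem d.1).inter hU.isClosed_compl).isCompact)
    (fun d => (isClosed_mem d.1).inter hU.isClosed_compl)
  rw [Set.mem_iInter] at hG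
  exact (hG ⟨⊤, F.top_mem⟩).2 (hU' (le_iff.2 fun a ha => (hG ⟨a, ha⟩).1) hF)

end Lattice

section Heyting

variable {A B D E : Type w} [HeytingAlgebra A] [HeytingAlgebra B] [HeytingAlgebra D]
  [HeytingAlgebra E]

/-- Inverse image of prime filters along a homomorphism. -/
def comap (h : HeytingHom A B) : PrimeFilters B →Co PrimeFilters A where
  toFun F := ⟨fun a => F.1 (h a), by simp [F.2.1], by simp [F.2.2.1], by simp [F.2.2.2.1],
    by simp [F.2.2.2.2]⟩
  monotone' _ _ hFG a := hFG (h a)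
  continuous_toFun := Continuous.subtype_mk (continuous_pi fun a => continuous_apply (h a)) _

theorem mem_comap {h : HeytingHom A B} {F : PrimeFilters B} {a : A} :
    a ∈ comap h F ↔ h a ∈ F := Iff.rfl

theorem interpolation_comap {f : HeytingHom A B} {g : HeytingHom A D} {i : HeytingHom B E}
    {j : HeytingHom D E} (h : Interpolation f g i j) :
    Interpolation (comap i) (comap j) (comap f) (comap g) := by
  intro F G hFG
  obtain ⟨H, h₁, h₂⟩ := exists_separating (Φ := i '' F) (Ψ := j '' (G : Set D)ᶜ)
    ⟨⊤, F.top_mem, map_top i⟩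
    (by
      rintro _ ⟨a, ha, rfl⟩ _ ⟨b, hb, rfl⟩
      exact ⟨a ⊓ b, F.inf_mem_iff.2 ⟨ha, hb⟩, map_inf i a b⟩)
    ⟨⊥, G.bot_notMem, map_bot j⟩
    (by
      rintro _ ⟨a, ha, rfl⟩ _ ⟨b, hb, rfl⟩
      exact ⟨a ⊔ b, fun h => (G.sup_mem_iff.1 h).elim ha hb, map_sup j a b⟩)
    (by
      rintro _ ⟨b, hb, rfl⟩ _ ⟨c, hc, rfl⟩ hbc
      obtain ⟨a, hba, hac⟩ := h b c hbc
      exact hc (mem_of_le hac (le_iff.1 hFG a (mem_comap.2 (mem_of_le hba hb)))))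
  refine ⟨H, le_iff.2 fun b hb => h₁ _ ⟨b, hb, rfl⟩, le_iff.2 fun c hc => ?_⟩
  by_contra hcG
  exact h₂ _ ⟨c, hcG, rfl⟩ hc

theorem exists_comap_eq (h : HeytingHom A B) {Φ : Set B} (hΦ : ⊤ ∈ Φ)
    (hΦ' : ∀ a ∈ Φ, ∀ b ∈ Φ, a ⊓ b ∈ Φ) (G : PrimeFilters A)
    (hG : ∀ b ∈ Φ, ∀ a, b ≤ h a → a ∈ G) :
    ∃ H : PrimeFilters B, (∀ b ∈ Φ, b ∈ H) ∧ comap h H = G := by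
  obtain ⟨H, h₁, h₂⟩ := exists_separating (Φ := {x | ∃ b ∈ Φ, ∃ a ∈ G, x = b ⊓ h a})
    (Ψ := h '' (G : Set A)ᶜ) ⟨⊤, hΦ, ⊤, G.top_mem, by simp⟩
    (by
      rintro _ ⟨b, hb, a, ha, rfl⟩ _ ⟨b', hb', a', ha', rfl⟩
      exact ⟨b ⊓ b', hΦ' b hb b' hb', a ⊓ a', G.inf_mem_iff.2 ⟨ha, ha'⟩, by
        rw [map_inf, inf_inf_inf_comm]⟩)
    ⟨⊥, G.bot_notMem, map_bot h⟩
    (by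
      rintro _ ⟨a, ha, rfl⟩ _ ⟨b, hb, rfl⟩
      exact ⟨a ⊔ b, fun h => (G.sup_mem_iff.1 h).elim ha hb, map_sup h a b⟩)
    (by
      rintro _ ⟨b, hb, a, ha, rfl⟩ _ ⟨c, hc, rfl⟩ hle
      rw [← le_himp_iff, ← map_himp] at hle
      exact hc (mem_of_le inf_himp_le (G.inf_mem_iff.2 ⟨ha, hG b hb _ hle⟩)))
  refine ⟨H, fun b hb => h₁ b ⟨b, hb, ⊤, G.top_mem, by simp⟩, ?_⟩
  refine SetLike.ext fun a => ⟨fun ha => ?_, fun ha => ?_⟩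
  · by_contra haG
    exact h₂ _ ⟨a, haG, rfl⟩ ha
  · exact h₁ _ ⟨⊤, hΦ, a, ha, by simp⟩

theorem isBoundedOrderMap_comap (h : HeytingHom A B) : IsBoundedOrderMap (comap h) := by
  refine .of_exists fun F G hFG => ?_
  obtain ⟨H, h₁, h₂⟩ := exists_comap_eq h (Φ := F) F.top_mem
    (fun a ha b hb => F.inf_mem_iff.2 ⟨ha, hb⟩) G
    (fun b hb a hba => le_iff.1 hFG a (mem_comap.2 (mem_of_le hba hb)))
  exact ⟨H, le_iff.2 h₁, h₂⟩

theorem exists_mem_comap_eq {h : HeytingHom A B} {l : B → A} (hl : GaloisConnection l h) {d : B}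
    {G : PrimeFilters A} (hG : l d ∈ G) : ∃ H : PrimeFilters B, d ∈ H ∧ comap h H = G := by
  obtain ⟨H, h₁, h₂⟩ := exists_comap_eq h (Φ := Set.Ici d) le_top (fun a ha b hb => le_inf ha hb)
    G (fun b hb a hba => mem_of_le ((hl _ _).2 (le_trans hb hba)) hG)
  exact ⟨H, h₁ d le_rfl, h₂⟩

theorem isLowerSemiOpen_comap {h : HeytingHom A B} {l : B → A} (hl : GaloisConnection l h) :
    IsLowerSemiOpen (comap h) := by
  refine fun U hU hU' => ⟨isOpen_iff_mem_nhds.2 ?_, isBoundedOrderMap_comap h U hU'⟩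
  rintro _ ⟨F, hF, rfl⟩
  obtain ⟨d, hd, hdU⟩ := exists_mem_subset hU hU' hF
  refine Filter.mem_of_superset ((isOpen_mem (l d)).mem_nhds (mem_comap.2 (mem_of_le (hl.le_u_l d) hd))) ?_
  intro G hG
  obtain ⟨H, hH, rfl⟩ := exists_mem_comap_eq hl hG
  exact ⟨H, hdU H hH, rfl⟩

/-- A homomorphism whose inverse image map reflects the order is surjective. -/
theorem surjective_of_comap_le (h : HeytingHom A B)
    (hle : ∀ F G : PrimeFilters B, comap h F ≤ comap h G → F ≤ G) : Function.Surjective h := by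
  intro d
  by_contra! hd
  obtain ⟨G, h₁, h₂⟩ := exists_separating (Φ := {x | ∃ a, d ≤ h a ∧ x = h a}) (Ψ := Set.Iic d)
    ⟨⊤, by simp, by simp⟩
    (by
      rintro _ ⟨a, ha, rfl⟩ _ ⟨b, hb, rfl⟩
      exact ⟨a ⊓ b, by rw [map_inf]; exact le_inf ha hb, (map_inf h a b).symm⟩)
    bot_le (fun a ha b hb => sup_le ha hb)
    (by
      rintro _ ⟨a, ha, rfl⟩ b hb hab
      exact hd a ((hab.trans hb).antisymm ha))
  obtain ⟨F, h₃, h₄⟩ := exists_separating (Φ := Set.Ici d) (Ψ := h '' {a | h a ∉ G})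
    le_top (fun a ha b hb => le_inf ha hb)
    ⟨⊥, by simpa using G.bot_notMem, map_bot h⟩
    (by
      rintro _ ⟨a, ha, rfl⟩ _ ⟨b, hb, rfl⟩
      refine ⟨a ⊔ b, fun hh => ?_, map_sup h a b⟩
      rw [map_sup] at hh
      exact (G.sup_mem_iff.1 hh).elim ha hb)
    (by
      rintro b hb _ ⟨a, ha, rfl⟩ hba
      exact ha (h₁ _ ⟨a, le_trans hb hba, rfl⟩))
  refine h₂ d le_rfl (le_iff.1 (hle F G (le_iff.2 fun a ha => ?_)) d (h₃ d le_rfl))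
  by_contra haG
  exact h₄ _ ⟨a, haG, rfl⟩ ha

end Heyting

end PrimeFilters

end Duality

section DualSpace

variable {C : Type u} [Category.{v} C]

/-- The functor of prime filters of a functor to Heyting algebras. -/
def dualSpace (D : C ⥤ HeytAlg.{w}) : Cᵒᵖ ⥤ KOrd.{w} where
  obj n := { carrier := PrimeFilters (D.obj n.unop) }
  map σ := ⟨PrimeFilters.comap (D.map σ.unop).hom⟩
  map_id n := KOrd.Hom.ext (ContinuousOrderHom.ext fun F => by
    change PrimeFilters.comap (D.map (𝟙 n.unop)).hom F = F
    rw [D.map_id]; rfl)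
  map_comp {n m k} σ ρ := KOrd.Hom.ext (ContinuousOrderHom.ext fun F => by
    change PrimeFilters.comap (D.map (ρ.unop ≫ σ.unop)).hom F =
      PrimeFilters.comap (D.map ρ.unop).hom (PrimeFilters.comap (D.map σ.unop).hom F)
    rw [D.map_comp]; rfl)

/-- The map of prime filters induced by a natural transformation. -/
def dualMap {D₁ D₂ : C ⥤ HeytAlg.{w}} (τ : D₁ ⟶ D₂) : dualSpace D₂ ⟶ dualSpace D₁ where
  app n := ⟨PrimeFilters.comap (τ.app n.unop).hom⟩
  naturality n m σ := KOrd.Hom.ext (ContinuousOrderHom.ext fun (F : PrimeFilters _) => by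
    change PrimeFilters.comap (τ.app m.unop).hom (PrimeFilters.comap (D₂.map σ.unop).hom F) =
      PrimeFilters.comap (D₁.map σ.unop).hom (PrimeFilters.comap (τ.app n.unop).hom F)
    refine SetLike.ext fun a => ?_
    change D₂.map σ.unop (τ.app _ a) ∈ F ↔ τ.app _ (D₁.map σ.unop a) ∈ F
    rw [← NatTrans.naturality_apply])

theorem IsIntuitionisticHyperdoctrine.isPolyadic {D : C ⥤ HeytAlg.{w}}
    (hD : IsIntuitionisticHyperdoctrine D) : IsPolyadic (dualSpace D) where
  interpolation h := PrimeFilters.interpolation_comap (hD.interpolation h)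
  bounded σ := PrimeFilters.isBoundedOrderMap_comap (D.map σ).hom

theorem IsIntuitionisticHyperdoctrine.isOpenPolyadic {D : C ⥤ HeytAlg.{w}}
    (hD : IsIntuitionisticHyperdoctrine D) : IsOpenPolyadic (dualSpace D) := fun σ =>
  let ⟨_, hl⟩ := hD.leftAdjoint σ
  PrimeFilters.isLowerSemiOpen_comap hl

theorem IsIntuitionisticHyperdoctrineMorphism.isIntuitionisticMorphism {D₁ D₂ : C ⥤ HeytAlg.{w}}
    {τ : D₁ ⟶ D₂} (hτ : IsIntuitionisticHyperdoctrineMorphism τ) :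
    IsIntuitionisticMorphism (dualMap τ) where
  isPolyadicMorphism σ := PrimeFilters.interpolation_comap (hτ.interpolation_le σ)
  bounded n := PrimeFilters.isBoundedOrderMap_comap (τ.app n).hom
  interpolation_ge σ := PrimeFilters.interpolation_comap (hτ.interpolation_ge σ)

variable {D : C ⥤ HeytAlg.{v}} {X : Cᵒᵖ ⥤ Type v}

/-- The prime filter of formulas satisfied by `p`. -/
def typeOf (x : X ⋙ betaFunctor ⟶ dualSpace D) {n : C} (p : X.obj (op n)) :
    PrimeFilters (D.obj n) :=
  x.app (op n) (pure p : Ultrafilter (X.obj (op n)))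

theorem typeOf_map (x : X ⋙ betaFunctor ⟶ dualSpace D) {n m : C} (σ : n ⟶ m)
    (p : X.obj (op m)) :
    typeOf x (X.map σ.op p) = PrimeFilters.comap (D.map σ).hom (typeOf x p) := by
  have h := KOrd.naturality_apply x σ.op (pure p : Ultrafilter (X.obj (op m)))
  refine Eq.trans ?_ h
  refine congrArg (x.app (op n)) ?_
  exact (Ultrafilter.map_pure (X.map σ.op) p).symm

/-- The interpretation of formulas in the ind-object underlying a model. -/
def interpretation (x : X ⋙ betaFunctor ⟶ dualSpace D) :
    underlyingLattices D ⟶ predicateHyperdoctrine X where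
  app n := BddDistLat.ofHom
    { toFun := fun d => ({p | d ∈ typeOf x p} : Set (X.obj (op n)))
      map_sup' := fun a b => Set.ext fun p => (typeOf x p).sup_mem_iff
      map_inf' := fun a b => Set.ext fun p => (typeOf x p).inf_mem_iff
      map_top' := Set.ext fun p => iff_true_intro (typeOf x p).top_mem
      map_bot' := Set.ext fun p => iff_false_intro (typeOf x p).bot_notMem }
  naturality n m σ := by
    refine ConcreteCategory.hom_ext _ _ fun d => Set.ext fun p => ?_
    change D.map σ d ∈ typeOf x p ↔ d ∈ typeOf x (X.map σ.op p)
    rw [typeOf_map]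
    rfl

theorem isModelOfHyperdoctrine_interpretation (hD : IsIntuitionisticHyperdoctrine D)
    {x : X ⋙ betaFunctor ⟶ dualSpace D} (hx : IsModelOfSpace x) :
    IsModelOfHyperdoctrine (interpretation x) := by
  refine ⟨hx.1, fun {n m} σ b c hbc => ?_⟩
  obtain ⟨l, hl⟩ := hD.leftAdjoint σ
  refine ⟨l b, hl.le_u_l b, fun p hp => ?_⟩
  obtain ⟨F, hF, hFp⟩ := PrimeFilters.exists_mem_comap_eq (h := (D.map σ).hom) hl
    (G := typeOf x p) hp
  obtain ⟨t, hFt, htp⟩ := hx.2 σ F (pure p : Ultrafilter (X.obj (op n))) hFp.le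
  change Ultrafilter (X.obj (op m)) at t
  change t.map (X.map σ.op) = pure p at htp
  have h₁ : {q | b ∈ typeOf x q} ∈ t := by
    have hc : Continuous fun t : Ultrafilter (X.obj (op m)) => x.app (op m) t :=
      KOrd.continuous_hom (x.app (op m))
    have ho := (PrimeFilters.isOpen_mem b).preimage hc
    have htm : t ∈ (fun t : Ultrafilter (X.obj (op m)) => x.app (op m) t) ⁻¹'
        {F : PrimeFilters (D.obj m) | b ∈ F} := PrimeFilters.le_iff.1 hFt b hF
    exact Ultrafilter.tendsto_pure_self t (ho.mem_nhds htm)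
  have h₂ : {q | X.map σ.op q = p} ∈ t := by
    have : {p} ∈ t.map (X.map σ.op) := by rw [htp]; exact rfl
    exact this
  obtain ⟨q, hq, rfl⟩ := t.nonempty_of_mem (Filter.inter_mem h₁ h₂)
  exact hbc hq

theorem IsCoherentMorphism.comp_whiskerRight {D₁ D₂ : C ⥤ HeytAlg.{v}} {τ : D₁ ⟶ D₂}
    (hτ : IsIntuitionisticHyperdoctrineMorphism τ)
    {a : underlyingLattices D₂ ⟶ predicateHyperdoctrine X} (ha : IsCoherentMorphism a) :
    IsCoherentMorphism (Functor.whiskerRight τ (forget₂ HeytAlg BddDistLat) ≫ a) := by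
  intro n m σ b c hbc
  obtain ⟨d, hd, hdc⟩ := ha σ (τ.app m b) c hbc
  obtain ⟨e, he, hed⟩ := hτ.interpolation_le σ b d hd
  exact ⟨e, he, le_trans (OrderHomClass.mono (a.app n).hom hed) hdc⟩

theorem injectiveOnModels_dualMap {D₁ D₂ : C ⥤ HeytAlg.{v}} {τ : D₁ ⟶ D₂}
    (hD₂ : IsIntuitionisticHyperdoctrine D₂) (hτ : IsIntuitionisticHyperdoctrineMorphism τ)
    (h : ModelsExtendAtMostOnce τ) : InjectiveOnModels (dualMap τ) := by
  intro X x y hx hy hxy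
  have hX := isModelOfHyperdoctrine_interpretation hD₂ hx
  have hY := isModelOfHyperdoctrine_interpretation hD₂ hy
  have heq := h X _ (interpretation x) (interpretation y)
    ⟨hX.1, IsCoherentMorphism.comp_whiskerRight hτ hX.2⟩ hX hY rfl (by
      refine NatTrans.ext (funext fun n => ?_)
      refine ConcreteCategory.hom_ext _ _ fun d => Set.ext fun p => ?_
      have hp : PrimeFilters.comap (τ.app n).hom (typeOf x p) =
          PrimeFilters.comap (τ.app n).hom (typeOf y p) :=
        congrArg (fun t => t.app (op n) (pure p : Ultrafilter (X.obj (op n)))) hxy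
      exact (SetLike.ext_iff.1 hp d).symm)
  refine betaFunctor_hom_ext fun n p => ?_
  change typeOf x p = typeOf y p
  refine SetLike.ext fun d => ?_
  exact Set.ext_iff.1 (congrArg (fun t => t.app n.unop d) heq) p

end DualSpace

theorem mainTheorem9 {C : Type u} [Category.{v} C] [EssentiallySmall.{v} C] [HasPushouts C] :
    (∀ (S P : Cᵒᵖ ⥤ KOrd.{v}) (f : S ⟶ P),
      IsPolyadic S → IsPolyadic P → IsOpenPolyadic S → IsIntuitionisticMorphism f →
      InjectiveOnModels f → IsPointwiseEmbedding f) ∧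
    (∀ (D₁ D₂ : C ⥤ HeytAlg.{v}) (τ : D₁ ⟶ D₂),
      IsIntuitionisticHyperdoctrine D₁ → IsIntuitionisticHyperdoctrine D₂ →
      IsIntuitionisticHyperdoctrineMorphism τ → ModelsExtendAtMostOnce τ →
      ∀ n : C, Function.Surjective (τ.app n)) := by
  refine ⟨fun S P f hS _ hSo hf hinj => hf.isPointwiseEmbedding hS hSo hinj,
    fun D₁ D₂ τ _ hD₂ hτ h n => ?_⟩
  exact PrimeFilters.surjective_of_comap_le (τ.app n).hom fun F G hFG =>
    hτ.isIntuitionisticMorphism.le_of_app_le hD₂.isPolyadic hD₂.isOpenPolyadic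
      (injectiveOnModels_dualMap hD₂ hτ h) (x := F) (y := G) hFG
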